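/- For each horizon $T\ge 1$ consider an experiment on one unit. The real potential outcomes $Y_t(w_{1:t})$, $t\le T$, $w_{1:t}\in\{0,1\}^t$ (which may depend on $T$), are held fixed; treatments $W_1,\dots,W_T\in\{0,1\}$ are random, and all probabilities, expectations and variances below are taken over the randomization distribution, i.e. the law given $Y_{1:T}(\bullet)$. Let $(\mathcal F_{T,t})_t$ be a filtration such that $W_{1:t}$ is $\mathcal F_{T,t}$-measurable, and put $p_t(b)=\Pr(W_t=b\mid\mathcal F_{T,t-1})$ and $$\tau_{t,0}=Y_t(W_{1:t-1},1)-Y_t(W_{1:t-1},0),\qquad \hat\tau_{t,0}=\frac{1_{W_t=1}Y_t(W_{1:t-1},1)}{p_t(1)}-\frac{1_{W_t=0}Y_t(W_{1:t-1},0)}{p_t(0)},\qquad u_{t,0}=\hat\tau_{t,0}-\tau_{t,0},$$ $\bar\tau=\frac1T\sum_{t=1}^T\tau_{t,0}$ and $\hat{\bar\tau}=\frac1T\sum_{t=1}^T\hat\tau_{t,0}$. Assume that treatment is non-anticipating: for all $t\le T$ and all $w_{1:t-1}$, $\Pr(W_t=b\mid W_{1:t-1}=w_{1:t-1},Y_{1:T}(\bullet))$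 depends on $Y_{1:T}(\bullet)$ only through $Y_1(w_1),\dots,Y_{t-1}(w_{1:t-1})$. Assume also that it is probabilistic: $0<p_t(1)<1$ almost surely for all $t\le T$. Then, for every $T\ge1$, $$\mathrm{Var}\Big(\sqrt T\,\frac1T\sum_{t=1}^T u_{t,0}\Big)=\frac1T\sum_{t=1}^T\mathrm{Var}(u_{t,0}),$$ as an identity in $[0,\infty]$. Suppose moreover that the potential outcomes are bounded uniformly in $t$ and $T$ and that the assignment is probabilistic uniformly, i.e. there is $\delta>0$ with $\delta\le p_t(1)\le 1-\delta$ almost surely for all $t\le T$ and all $T$. Then the $u_{t,0}$ are square-integrable, their variances are bounded uniformly in $t\le T$ and $T$ (so the identity above holds between finite numbers), and $\sqrt T(\hat{\bar\tau}-\bar\tau)=O_p(1)$ as $T\to\infty$. If in addition, for some real $\eta$, $\frac1T\sum_{t=1}^T\mathrm{Var}(u_{t,0}\mid\mathcal F_{T,t-1})\to\eta^2$ in probability, then $$\sqrt T\,\frac1T\sum_{t=1}^T u_{t,0}\ \xrightarrow{d}\ N(0,\eta^2).$$ -/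

import Mathlib

open MeasureTheory ProbabilityTheory Filter Topology
open scoped ENNReal NNReal

noncomputable section

namespace TimeSeriesExperiment

/-- A schedule of (scalar) potential outcomes `Y_t(w_{1:t})`, for times `t = 1, 2, …` and treatment
paths `w_{1:t} ∈ {0,1}^t`; treatment is `true`, control is `false`. -/
abbrev PotentialOutcomes : Type := (t : ℕ) → (Fin t → Bool) → ℝ

/-- The first `t` entries `w_{1:t} = (w_1, …, w_t)` of the treatments `w_1, w_2, …`
(the value `w 0` is never used). -/
def path (w : ℕ → Bool) (t : ℕ) : Fin t → Bool := fun i => w (i + 1)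

/-- A time series experiment on one unit. `W t` is the treatment administered at time `t ≥ 1`,
`𝓕 t` is the information available after time `t`; it contains at least `W_{1:t}`.
`law y` is the randomization distribution when the potential outcomes are held fixed at `y`,
i.e. the conditional law given that the schedule of potential outcomes equals `y`. -/
structure Experiment (Ω : Type*) [mΩ : MeasurableSpace Ω] where
  W : ℕ → Ω → Bool
  𝓕 : Filtration ℕ mΩ
  measurable_W : ∀ t, 1 ≤ t → Measurable[𝓕 t] (W t)
  law : PotentialOutcomes → Measure Ω
  isProbabilityMeasure_law : ∀ y, IsProbabilityMeasure (law y)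

namespace Experiment

attribute [instance] Experiment.isProbabilityMeasure_law

variable {Ω : Type*} [mΩ : MeasurableSpace Ω] (E : Experiment Ω)

/-- The event `W_{1:t} = w_{1:t}`. -/
def pastEvent (w : ℕ → Bool) (t : ℕ) : Set Ω := {ω | ∀ s ∈ Finset.Icc 1 t, E.W s ω = w s}

/-- Non-anticipating treatment up to time `T`: for every `t ≤ T`, the conditional probability
`Pr(W_t = b | W_{1:t-1} = w_{1:t-1}, Y_{1:T}(•) = y)` depends on the potential outcomes `y` only
through those that follow the treatment path, `Y_1(w_1), …, Y_{t-1}(w_{1:t-1})`. -/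
def NonAnticipating (T : ℕ) : Prop :=
  ∀ t ∈ Finset.Icc 1 T, ∀ (w : ℕ → Bool) (b : Bool) (y y' : PotentialOutcomes),
    (∀ s ∈ Finset.Icc 1 (t - 1), y s (path w s) = y' s (path w s)) →
    E.law y (E.pastEvent w (t - 1)) ≠ 0 → E.law y' (E.pastEvent w (t - 1)) ≠ 0 →
    cond (E.law y) (E.pastEvent w (t - 1)) {ω | E.W t ω = b} =
      cond (E.law y') (E.pastEvent w (t - 1)) {ω | E.W t ω = b}

/-- The adapted propensity score `p_t(b) = Pr(W_t = b | 𝓕_{t-1})`. -/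
def propensity (y : PotentialOutcomes) (t : ℕ) (b : Bool) : Ω → ℝ :=
  (E.law y)⟦{ω | E.W t ω = b} | E.𝓕 (t - 1)⟧

/-- Probabilistic treatment assignment up to time `T`: `0 < Pr(W_t = 1 | 𝓕_{t-1}) < 1`. -/
def Probabilistic (y : PotentialOutcomes) (T : ℕ) : Prop :=
  ∀ t ∈ Finset.Icc 1 T, ∀ᵐ ω ∂(E.law y),
    0 < E.propensity y t true ω ∧ E.propensity y t true ω < 1

/-- The potential outcome `Y_t(W_1, …, W_{t-1}, b)` along the realized past treatments. -/
def outcomeIf (y : PotentialOutcomes) (t : ℕ) (b : Bool) (ω : Ω) : ℝ :=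
  y t (path (Function.update (fun s => E.W s ω) t b) t)

/-- The contemporaneous causal effect
`τ_{t,0} = Y_t(W_{1:t-1}, 1) - Y_t(W_{1:t-1}, 0)`. -/
def effect (y : PotentialOutcomes) (t : ℕ) (ω : Ω) : ℝ :=
  E.outcomeIf y t true ω - E.outcomeIf y t false ω

/-- The Horvitz-Thompson estimator of `τ_{t,0}`,
`1_{W_t = 1} Y_t(W_{1:t-1}, 1) / p_t(1) - 1_{W_t = 0} Y_t(W_{1:t-1}, 0) / p_t(0)`. -/
def estimator (y : PotentialOutcomes) (t : ℕ) (ω : Ω) : ℝ :=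
  (if E.W t ω = true then E.outcomeIf y t true ω / E.propensity y t true ω else 0) -
    (if E.W t ω = false then E.outcomeIf y t false ω / E.propensity y t false ω else 0)

/-- The estimation error `u_{t,0}`. -/
def error (y : PotentialOutcomes) (t : ℕ) (ω : Ω) : ℝ := E.estimator y t ω - E.effect y t ω

/-- The temporal average effect `τ̄ = (1/T) ∑_{t=1}^T τ_{t,0}`. -/
def avgEffect (y : PotentialOutcomes) (T : ℕ) (ω : Ω) : ℝ :=
  (1 / (T : ℝ)) * ∑ t ∈ Finset.Icc 1 T, E.effect y t ω

/-- The estimator `(1/T) ∑_{t=1}^T τ̂_{t,0}` of the temporal average effect. -/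
def avgEstimator (y : PotentialOutcomes) (T : ℕ) (ω : Ω) : ℝ :=
  (1 / (T : ℝ)) * ∑ t ∈ Finset.Icc 1 T, E.estimator y t ω

/-- The scaled average error `√T · (1/T) ∑_{t=1}^T u_{t,0}`. -/
def scaledError (y : PotentialOutcomes) (T : ℕ) (ω : Ω) : ℝ :=
  √(T : ℝ) * ((1 / (T : ℝ)) * ∑ t ∈ Finset.Icc 1 T, E.error y t ω)

/-- The average conditional variance `(1/T) ∑_{t=1}^T Var(u_{t,0} | 𝓕_{t-1})`. -/
def avgCondVar (y : PotentialOutcomes) (T : ℕ) (ω : Ω) : ℝ :=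
  (1 / (T : ℝ)) * ∑ t ∈ Finset.Icc 1 T, (Var[E.error y t; E.law y | E.𝓕 (t - 1)]) ω

end Experiment

/-- `X_T = O_p(1)`, for real random variables `X_T`, `T ≥ 1`, on probability spaces
`(Ω_T, μ_T)`. -/
def BoundedInProbability {Ω : ℕ → Type*} [∀ T, MeasurableSpace (Ω T)]
    (μ : ∀ T, Measure (Ω T)) (X : ∀ T, Ω T → ℝ) : Prop :=
  ∀ ε : ℝ≥0∞, 0 < ε → ∃ M : ℝ, ∀ T, 1 ≤ T → μ T {ω | M < |X T ω|} ≤ ε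

/-- `X_T` converges in probability to the constant `c`, for real random variables `X_T` on
probability spaces `(Ω_T, μ_T)`. -/
def TendstoInProbabilityConst {Ω : ℕ → Type*} [∀ T, MeasurableSpace (Ω T)]
    (μ : ∀ T, Measure (Ω T)) (X : ∀ T, Ω T → ℝ) (c : ℝ) : Prop :=
  ∀ ε : ℝ, 0 < ε → Tendsto (fun T => μ T {ω | ε ≤ |X T ω - c|}) atTop (𝓝 0)

end TimeSeriesExperiment

end

open TimeSeriesExperiment

/-! Given `𝓕 (t - 1)`, both outcomes `Y_t(W_{1:t-1}, b)` are known and only `W_t` is random.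
Weighting by the inverse propensity therefore makes each estimator conditionally unbiased
(`condExp_indicator_div_condExp`, `condExp_error`), and the errors `u_t` are martingale differences.

The variance identity is the orthogonality of these differences. Without a uniform lower bound on
the propensities the variances may be infinite. Integrability survives, because the density of an
event given the past cancels the weight (`integrable_indicator_div_condExp`). If a sum `X + d` is in
L², so is its conditional expectation `X`, hence also `d`; infinite variances thus match on both
sides.

With bounded outcomes and propensities in `[δ, 1 - δ]`, the errors are bounded by a constant `C`.
Averaging the variances and applying Chebyshev gives `O_p(1)`.

For the limit law, let `S` be the scaled sum and `V` the sum of its conditional variances. The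
compensated exponential `exp(iθS + θ²V/2)` has expectation close to `1`: each step costs a cubic
Taylor remainder of order `n^(-3/2)`, and there are `n` steps. As `V` is bounded and tends to `η²`
in probability, `exp(θ²V/2)` can be replaced by `exp(θ²η²/2)`, which leaves the Gaussian
characteristic function. -/

section General

/-! ### Martingale differences: orthogonality and compensated characteristic functions. -/

variable {Ω : Type*} {m mΩ : MeasurableSpace Ω} {μ : Measure Ω}

/-- A bounded `m`-measurable complex factor sees a real function only through its conditional
expectation given `m`. -/
lemma integral_ofReal_condExp_mul [IsFiniteMeasure μ] (hm : m ≤ mΩ) {g : Ω → ℂ} {f : Ω → ℝ}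
    (hg : StronglyMeasurable[m] g) (hf : Integrable f μ) {K : ℝ} (hK : ∀ᵐ ω ∂μ, ‖g ω‖ ≤ K) :
    ∫ ω, (((μ[f | m]) ω : ℝ) : ℂ) * g ω ∂μ = ∫ ω, ((f ω : ℝ) : ℂ) * g ω ∂μ := by
  have h := condExp_stronglyMeasurable_bilin_of_bound
    (ContinuousLinearMap.lsmul ℝ ℝ : ℝ →L[ℝ] ℂ →L[ℝ] ℂ).flip hm hg hf K hK
  simp only [ContinuousLinearMap.flip_apply, ContinuousLinearMap.lsmul_apply,
    Complex.real_smul] at h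
  rw [← integral_congr_ae h, integral_condExp hm]

/-- Martingale differences are orthogonal, also when the variances are infinite. -/
lemma evariance_add_of_condExp_eq_zero [IsProbabilityMeasure μ] (hm : m ≤ mΩ) {X d : Ω → ℝ}
    (hX : StronglyMeasurable[m] X) (hXi : Integrable X μ) (hd : Integrable d μ)
    (hd0 : μ[d | m] =ᵐ[μ] 0) : eVar[X + d; μ] = eVar[X; μ] + eVar[d; μ] := by
  by_cases hL : MemLp X 2 μ ∧ MemLp d 2 μ
  · obtain ⟨h1, h2⟩ := hL
    have hint : Integrable (X * d) μ := h1.integrable_mul h2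
    have h0 : ∫ ω, d ω ∂μ = 0 := by
      rw [← integral_condExp hm, integral_congr_ae hd0]; simp
    have hXd : ∫ ω, (X * d) ω ∂μ = 0 := by
      rw [← integral_condExp hm, integral_congr_ae
        (condExp_mul_of_stronglyMeasurable_left hX hint hd), integral_eq_zero_of_ae]
      filter_upwards [hd0] with ω h
      simp [h]
    have hcov : cov[X, d; μ] = 0 := by
      rw [covariance_eq_sub h1 h2, hXd, h0]; simp
    rw [← (h1.add h2).ofReal_variance_eq, ← h1.ofReal_variance_eq, ← h2.ofReal_variance_eq,
      variance_add h1 h2, hcov, ← ENNReal.ofReal_add (variance_nonneg _ _) (variance_nonneg _ _)]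
    simp
  · have hsum : ¬ MemLp (X + d) 2 μ := by
      intro h
      -- Conditioning on `m` recovers `X` from `X + d`, and conditional expectation preserves L².
      have hce : μ[X + d | m] =ᵐ[μ] X := by
        filter_upwards [condExp_add hXi hd m, hd0] with ω h1 h2
        rw [h1, condExp_of_stronglyMeasurable hm hX hXi]
        simp [h2]
      have hXL : MemLp X 2 μ := (memLp_congr_ae hce).1 (h.condExp (by norm_num))
      exact hL ⟨hXL, by simpa using h.sub hXL⟩
    rw [evariance_eq_top (hXi.add hd).aestronglyMeasurable hsum]
    rw [not_and_or] at hL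
    rcases hL with h | h
    · rw [evariance_eq_top hXi.aestronglyMeasurable h, top_add]
    · rw [evariance_eq_top hd.aestronglyMeasurable h, add_top]

variable {𝓕 : Filtration ℕ mΩ} {d v : ℕ → Ω → ℝ} {n : ℕ}

lemma stronglyMeasurable_sum_range (hd : ∀ t < n, StronglyMeasurable[𝓕 (t + 1)] (d t)) :
    StronglyMeasurable[𝓕 n] (fun ω => ∑ t ∈ Finset.range n, d t ω) := by
  refine Finset.stronglyMeasurable_fun_sum _ fun t ht => ?_
  rw [Finset.mem_range] at ht
  exact (hd t ht).mono (𝓕.mono ht)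

lemma evariance_sum_range_of_condExp_eq_zero [IsProbabilityMeasure μ]
    (hd : ∀ t < n, StronglyMeasurable[𝓕 (t + 1)] (d t)) (hi : ∀ t < n, Integrable (d t) μ)
    (h0 : ∀ t < n, μ[d t | 𝓕 t] =ᵐ[μ] 0) :
    eVar[fun ω => ∑ t ∈ Finset.range n, d t ω; μ] = ∑ t ∈ Finset.range n, eVar[d t; μ] := by
  induction n with
  | zero => simp [evariance]
  | succ n ih =>
    rw [Finset.sum_range_succ, ← ih (fun t ht => hd t (by omega)) (fun t ht => hi t (by omega))
      (fun t ht => h0 t (by omega)), ← evariance_add_of_condExp_eq_zero (𝓕.le n)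
      (stronglyMeasurable_sum_range fun t ht => hd t (by omega))
      (integrable_finsetSum _ fun t ht => hi t (by simp at ht; omega))
      (hi n (by omega)) (h0 n (by omega))]
    congr 1
    ext ω
    simp [Finset.sum_range_succ]

/-- Applied with `x = θ d` and `a = θ² v / 2`: the subtracted polynomial then has zero conditional
mean, so only this remainder matters. The second-order expansion of `exp(ix)` contributes `3 ε³`,
and the first-order expansion of `exp(-a)` contributes `a² ≤ ε³`. -/
lemma norm_exp_mul_I_sub_taylor_le {x a : ℝ} {ε : ℝ} (hε : ε ≤ 1) (hx : |x| ≤ ε)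
    (ha0 : 0 ≤ a) (ha : a ≤ ε ^ 2 / 2) :
    ‖Complex.exp (x * Complex.I) - Complex.exp (-(a : ℂ))
      - (x * Complex.I - ((x ^ 2 / 2 : ℝ) : ℂ) + a)‖ ≤ 4 * ε ^ 3 := by
  have hε0 : 0 ≤ ε := (abs_nonneg x).trans hx
  have h1 : ‖Complex.exp (x * Complex.I) - (1 + x * Complex.I - ((x ^ 2 / 2 : ℝ) : ℂ))‖
      ≤ 3 * ε ^ 3 := by
    have h := Complex.norm_exp_sub_sum_le_norm_mul_exp ((x : ℂ) * Complex.I) 3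
    have hn : ‖(x : ℂ) * Complex.I‖ = |x| := by simp
    rw [hn] at h
    have he : ∑ k ∈ Finset.range 3, ((x : ℂ) * Complex.I) ^ k / (k.factorial : ℂ)
        = 1 + x * Complex.I - ((x ^ 2 / 2 : ℝ) : ℂ) := by
      simp [Finset.sum_range_succ, mul_pow, Nat.factorial]
      ring
    rw [he] at h
    refine h.trans ?_
    have h3 : |x| ^ 3 ≤ ε ^ 3 := by gcongr
    have h4 : Real.exp |x| ≤ 3 := by
      refine (Real.exp_le_exp.2 (hx.trans hε)).trans ?_
      linarith [Real.exp_one_lt_d9]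
    calc |x| ^ 3 * Real.exp |x| ≤ ε ^ 3 * 3 := by gcongr
      _ = 3 * ε ^ 3 := by ring
  have hε2 : ε ^ 2 ≤ 1 := by nlinarith
  have h2 : ‖Complex.exp (-(a : ℂ)) - 1 - (-(a : ℂ))‖ ≤ ε ^ 3 := by
    have hn : ‖-(a : ℂ)‖ = a := by simp [abs_of_nonneg ha0]
    have h := Complex.norm_exp_sub_one_sub_id_le (x := -(a : ℂ)) (by rw [hn]; linarith)
    rw [hn] at h
    refine h.trans ?_
    nlinarith [pow_le_pow_left₀ ha0 ha 2, pow_nonneg hε0 3]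
  calc _ = ‖(Complex.exp (x * Complex.I) - (1 + x * Complex.I - ((x ^ 2 / 2 : ℝ) : ℂ)))
        - (Complex.exp (-(a : ℂ)) - 1 - (-(a : ℂ)))‖ := by congr 1; ring
    _ ≤ _ := norm_sub_le _ _
    _ ≤ _ := by linarith

/-- The characteristic function of a sum of bounded martingale differences `d t`, compensated by
the conditional variances `v t`, is close to `1`. -/
lemma norm_integral_exp_compensated_sub_one_le [IsProbabilityMeasure μ] {θ ε K : ℝ}
    (hd : ∀ t < n, StronglyMeasurable[𝓕 (t + 1)] (d t))
    (hv : ∀ t < n, StronglyMeasurable[𝓕 t] (v t))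
    (hbd : ∀ t < n, ∀ᵐ ω ∂μ, |d t ω| ≤ ε)
    (h0 : ∀ t < n, μ[d t | 𝓕 t] =ᵐ[μ] 0)
    (hvar : ∀ t < n, v t =ᵐ[μ] μ[fun ω => d t ω ^ 2 | 𝓕 t])
    (hbv : ∀ t < n, ∀ᵐ ω ∂μ, 0 ≤ v t ω ∧ v t ω ≤ ε ^ 2)
    (hθ : |θ| * ε ≤ 1) (hK : n * ε ^ 2 ≤ K) :
    ‖∫ ω, Complex.exp ((θ * ∑ t ∈ Finset.range n, d t ω : ℝ) * Complex.I
        + (θ ^ 2 / 2 * ∑ t ∈ Finset.range n, v t ω : ℝ)) ∂μ - 1‖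
      ≤ n * (4 * (|θ| * ε) ^ 3 * Real.exp (θ ^ 2 / 2 * K)) := by
  induction n with
  | zero => simp
  | succ n ih =>
    have hKn : n * ε ^ 2 ≤ K := by
      push_cast at hK; nlinarith [sq_nonneg ε]
    specialize ih (fun t ht => hd t (by omega)) (fun t ht => hv t (by omega))
      (fun t ht => hbd t (by omega)) (fun t ht => h0 t (by omega))
      (fun t ht => hvar t (by omega)) (fun t ht => hbv t (by omega)) hKn
    set S : Ω → ℝ := fun ω => ∑ t ∈ Finset.range n, d t ω with hS
    set V : Ω → ℝ := fun ω => ∑ t ∈ Finset.range n, v t ω with hV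
    have hSm : StronglyMeasurable[𝓕 n] S :=
      stronglyMeasurable_sum_range fun t ht => hd t (by omega)
    have hVm : StronglyMeasurable[𝓕 n] V := by
      refine Finset.stronglyMeasurable_fun_sum _ fun t ht => ?_
      rw [Finset.mem_range] at ht
      exact (hv t (by omega)).mono (𝓕.mono ht.le)
    have hvm := hv n (by omega)
    have hdm := hd n (by omega)
    have hVall : ∀ᵐ ω ∂μ, ∀ t < n + 1, 0 ≤ v t ω ∧ v t ω ≤ ε ^ 2 := by
      rw [ae_all_iff]; intro t
      by_cases ht : t < n + 1
      · filter_upwards [hbv t ht] with ω h _ using h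
      · exact ae_of_all _ fun ω h => absurd h ht
    have hVn : ∀ᵐ ω ∂μ, V ω + v n ω ≤ K := by
      filter_upwards [hVall] with ω h
      calc V ω + v n ω = ∑ t ∈ Finset.range (n + 1), v t ω := by
            rw [Finset.sum_range_succ]
        _ ≤ ∑ t ∈ Finset.range (n + 1), ε ^ 2 :=
            Finset.sum_le_sum fun t ht => (h t (Finset.mem_range.1 ht)).2
        _ ≤ K := by simpa using hK
    set Z : Ω → ℂ := fun ω => Complex.exp ((θ * S ω : ℝ) * Complex.I + (θ ^ 2 / 2 * V ω : ℝ))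
      with hZ
    -- The compensator `v n` of the next step is already `𝓕 n`-measurable, so `G` is too. The old
    -- exponential is `Z = exp(-θ² v n / 2) G` and the new one is `exp(iθ d n) G`.
    set G : Ω → ℂ := fun ω => Complex.exp ((θ * S ω : ℝ) * Complex.I
      + (θ ^ 2 / 2 * (V ω + v n ω) : ℝ)) with hG
    have hGm : StronglyMeasurable[𝓕 n] G := by
      refine Complex.continuous_exp.comp_stronglyMeasurable (.add (.mul_const ?_ _) ?_)
      · exact Complex.continuous_ofReal.comp_stronglyMeasurable (hSm.const_mul θ)
      · exact Complex.continuous_ofReal.comp_stronglyMeasurable ((hVm.add hvm).const_mul _)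
    have hGK : ∀ᵐ ω ∂μ, ‖G ω‖ ≤ Real.exp (θ ^ 2 / 2 * K) := by
      filter_upwards [hVn] with ω h
      rw [hG, Complex.norm_exp]
      simp only [Complex.add_re, Complex.mul_re, Complex.ofReal_re, Complex.ofReal_im,
        Complex.I_re, Complex.I_im]
      refine Real.exp_le_exp.2 ?_
      have : θ ^ 2 / 2 * (V ω + v n ω) ≤ θ ^ 2 / 2 * K := by gcongr
      linarith
    have hGi : Integrable G μ :=
      Integrable.of_bound (hGm.mono (𝓕.le n)).aestronglyMeasurable _ hGK
    have hmul : ∀ {f : Ω → ℂ} {c : ℝ}, AEStronglyMeasurable f μ → (∀ᵐ ω ∂μ, ‖f ω‖ ≤ c) →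
        Integrable (fun ω => f ω * G ω) μ := fun hf hc => hGi.bdd_mul hf hc
    have hdm' : AEStronglyMeasurable (d n) μ := (hdm.mono (𝓕.le _)).aestronglyMeasurable
    have hvm' : AEStronglyMeasurable (v n) μ := (hvm.mono (𝓕.le _)).aestronglyMeasurable
    have hdi : Integrable (d n) μ :=
      Integrable.of_bound hdm' ε (by simpa using hbd n (by omega))
    have hd2b : ∀ᵐ ω ∂μ, ‖d n ω ^ 2‖ ≤ ε ^ 2 := by
      filter_upwards [hbd n (by omega)] with ω h
      rw [norm_pow, Real.norm_eq_abs]; gcongr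
    have hd2i : Integrable (fun ω => d n ω ^ 2) μ := Integrable.of_bound (hdm'.pow 2) _ hd2b
    -- The linear Taylor term vanishes against `G`; by `hG2` the two quadratic terms cancel.
    have hG1 : ∫ ω, (d n ω : ℂ) * G ω ∂μ = 0 := by
      rw [← integral_ofReal_condExp_mul (𝓕.le n) hGm hdi hGK, integral_eq_zero_of_ae]
      filter_upwards [h0 n (by omega)] with ω h
      simp [h]
    have hG2 : ∫ ω, (v n ω : ℂ) * G ω ∂μ = ∫ ω, ((d n ω ^ 2 : ℝ) : ℂ) * G ω ∂μ := by
      rw [← integral_ofReal_condExp_mul (𝓕.le n) hGm hd2i hGK]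
      refine integral_congr_ae ?_
      filter_upwards [hvar n (by omega)] with ω h
      rw [h]
    have hi1 : Integrable (fun ω => (d n ω : ℂ) * G ω) μ :=
      hmul (Complex.continuous_ofReal.comp_aestronglyMeasurable hdm') (c := ε)
        (by simpa using hbd n (by omega))
    have hi2 : Integrable (fun ω => ((d n ω ^ 2 : ℝ) : ℂ) * G ω) μ :=
      hmul (Complex.continuous_ofReal.comp_aestronglyMeasurable (hdm'.pow 2)) (c := ε ^ 2)
        (by filter_upwards [hd2b] with ω h using by rwa [Complex.norm_real])
    have hi3 : Integrable (fun ω => (v n ω : ℂ) * G ω) μ :=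
      hmul (Complex.continuous_ofReal.comp_aestronglyMeasurable hvm') (c := ε ^ 2)
        (by filter_upwards [hbv n (by omega)] with ω h using by
              rw [Complex.norm_real, Real.norm_of_nonneg h.1]; exact h.2)
    set R : Ω → ℂ := fun ω => Complex.exp ((θ * d n ω : ℝ) * Complex.I)
      - Complex.exp (-((θ ^ 2 / 2 * v n ω : ℝ) : ℂ))
      - ((θ * d n ω : ℝ) * Complex.I - (((θ * d n ω) ^ 2 / 2 : ℝ) : ℂ)
        + (θ ^ 2 / 2 * v n ω : ℝ)) with hR
    have hRb : ∀ᵐ ω ∂μ, ‖R ω‖ ≤ 4 * (|θ| * ε) ^ 3 := by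
      filter_upwards [hbd n (by omega), hbv n (by omega)] with ω h1 h2
      refine norm_exp_mul_I_sub_taylor_le hθ ?_ (mul_nonneg (by positivity) h2.1) ?_
      · rw [abs_mul]; gcongr
      · rw [mul_pow, sq_abs]
        have := mul_le_mul_of_nonneg_left h2.2 (sq_nonneg θ)
        linarith
    have hRm : AEStronglyMeasurable R μ := by
      have e1 : AEMeasurable (d n) μ := hdm'.aemeasurable
      have e2 : AEMeasurable (v n) μ := hvm'.aemeasurable
      refine AEMeasurable.aestronglyMeasurable ?_
      rw [hR]
      fun_prop
    have hi4 : Integrable (fun ω => R ω * G ω) μ := hmul hRm hRb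
    have hZi : Integrable Z μ := by
      refine Integrable.of_bound (C := Real.exp (θ ^ 2 / 2 * K)) ?_ ?_
      · suffices h : StronglyMeasurable[𝓕 n] Z from (h.mono (𝓕.le n)).aestronglyMeasurable
        refine Complex.continuous_exp.comp_stronglyMeasurable (.add (.mul_const ?_ _) ?_)
        · exact Complex.continuous_ofReal.comp_stronglyMeasurable (hSm.const_mul θ)
        · exact Complex.continuous_ofReal.comp_stronglyMeasurable (hVm.const_mul _)
      · filter_upwards [hVn, hbv n (by omega)] with ω h h'
        rw [hZ, Complex.norm_exp]
        simp only [Complex.add_re, Complex.mul_re, Complex.ofReal_re, Complex.ofReal_im,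
          Complex.I_re, Complex.I_im]
        refine Real.exp_le_exp.2 ?_
        have : θ ^ 2 / 2 * V ω ≤ θ ^ 2 / 2 * K := by gcongr; linarith [h'.1]
        linarith
    have hsplit : ∀ ω, Complex.exp ((θ * ∑ t ∈ Finset.range (n + 1), d t ω : ℝ) * Complex.I
        + (θ ^ 2 / 2 * ∑ t ∈ Finset.range (n + 1), v t ω : ℝ))
        = Z ω + (R ω * G ω + (θ * Complex.I) * ((d n ω : ℂ) * G ω)
          + (θ ^ 2 / 2 : ℂ) * ((v n ω : ℂ) * G ω)
          - (θ ^ 2 / 2 : ℂ) * (((d n ω ^ 2 : ℝ) : ℂ) * G ω)) := by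
      intro ω
      rw [Finset.sum_range_succ, Finset.sum_range_succ]
      have hz : Z ω = Complex.exp (-((θ ^ 2 / 2 * v n ω : ℝ) : ℂ)) * G ω := by
        rw [hZ, hG]
        simp only
        rw [← Complex.exp_add]
        congr 1
        push_cast
        ring
      have hl : Complex.exp ((θ * (∑ t ∈ Finset.range n, d t ω + d n ω) : ℝ) * Complex.I
          + (θ ^ 2 / 2 * (∑ t ∈ Finset.range n, v t ω + v n ω) : ℝ))
          = Complex.exp ((θ * d n ω : ℝ) * Complex.I) * G ω := by
        rw [hG]
        simp only
        rw [← Complex.exp_add]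
        congr 1
        simp only [hS, hV]
        push_cast
        ring
      rw [hl, hz, hR]
      push_cast
      ring
    have hint : ∫ ω, Complex.exp ((θ * ∑ t ∈ Finset.range (n + 1), d t ω : ℝ) * Complex.I
        + (θ ^ 2 / 2 * ∑ t ∈ Finset.range (n + 1), v t ω : ℝ)) ∂μ
        = ∫ ω, Z ω ∂μ + ∫ ω, R ω * G ω ∂μ := by
      simp_rw [hsplit]
      have h1 := hi1.const_mul (θ * Complex.I)
      have h2 := hi2.const_mul (θ ^ 2 / 2 : ℂ)
      have h3 := hi3.const_mul (θ ^ 2 / 2 : ℂ)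
      have h41 : Integrable (fun ω => R ω * G ω + (θ * Complex.I) * ((d n ω : ℂ) * G ω)) μ :=
        hi4.add h1
      have h413 : Integrable (fun ω => R ω * G ω + (θ * Complex.I) * ((d n ω : ℂ) * G ω)
          + (θ ^ 2 / 2 : ℂ) * ((v n ω : ℂ) * G ω)) μ := h41.add h3
      have h4132 : Integrable (fun ω => R ω * G ω + (θ * Complex.I) * ((d n ω : ℂ) * G ω)
          + (θ ^ 2 / 2 : ℂ) * ((v n ω : ℂ) * G ω)
          - (θ ^ 2 / 2 : ℂ) * (((d n ω ^ 2 : ℝ) : ℂ) * G ω)) μ := h413.sub h2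
      rw [integral_add hZi h4132, integral_sub h413 h2, integral_add h41 h3,
        integral_add hi4 h1, integral_const_mul, integral_const_mul,
        integral_const_mul, hG1, hG2]
      ring
    rw [hint]
    have hRG : ‖∫ ω, R ω * G ω ∂μ‖ ≤ 4 * (|θ| * ε) ^ 3 * Real.exp (θ ^ 2 / 2 * K) := by
      refine (norm_integral_le_of_norm_le_const (C := 4 * (|θ| * ε) ^ 3 * Real.exp (θ ^ 2 / 2 * K))
        ?_).trans (by simp)
      filter_upwards [hRb, hGK] with ω h1 h2
      rw [norm_mul]
      exact mul_le_mul h1 h2 (norm_nonneg _) ((norm_nonneg _).trans h1)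
    calc ‖∫ ω, Z ω ∂μ + ∫ ω, R ω * G ω ∂μ - 1‖
        = ‖(∫ ω, Z ω ∂μ - 1) + ∫ ω, R ω * G ω ∂μ‖ := by congr 1; ring
      _ ≤ ‖∫ ω, Z ω ∂μ - 1‖ + ‖∫ ω, R ω * G ω ∂μ‖ := norm_add_le _ _
      _ ≤ _ := by push_cast; linarith

end General

/-! ### Inverse probability weighting. -/

section InverseProbabilityWeighting

variable {Ω : Type*} {m mΩ : MeasurableSpace Ω} {μ : Measure Ω} [IsProbabilityMeasure μ]

/-- This is the defining property of conditional probability, put as a density so that nonnegative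
integrals over `A` can be rewritten before integrability is known. -/
lemma trim_restrict_eq_withDensity_condExp (hm : m ≤ mΩ) {A : Set Ω} (hA : MeasurableSet[mΩ] A) :
    (μ.restrict A).trim hm = (μ.trim hm).withDensity (fun ω => ENNReal.ofReal ((μ⟦A | m⟧) ω)) := by
  refine @Measure.ext _ m _ _ fun s hs => ?_
  have hpm : Measurable[m] fun ω => ENNReal.ofReal ((μ⟦A | m⟧) ω) :=
    ENNReal.measurable_ofReal.comp stronglyMeasurable_condExp.measurable
  have hi : Integrable (A.indicator fun _ => (1 : ℝ)) μ := (integrable_const 1).indicator hA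
  have hnn : 0 ≤ᵐ[μ] μ⟦A | m⟧ :=
    condExp_nonneg (ae_of_all _ fun ω => Set.indicator_nonneg (fun _ _ => zero_le_one) ω)
  rw [trim_measurableSet_eq hm hs, Measure.restrict_apply (hm s hs), withDensity_apply _ hs,
    restrict_trim hm μ hs, lintegral_trim hm hpm,
    ← ofReal_integral_eq_lintegral_ofReal integrable_condExp.integrableOn
      (ae_restrict_of_ae hnn), setIntegral_condExp hm hi hs, setIntegral_indicator hA]
  simp

/-- Inverse probability weighting is integrable as soon as the probability is positive. -/
lemma integrable_indicator_div_condExp (hm : m ≤ mΩ) {A : Set Ω} (hA : MeasurableSet[mΩ] A)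
    (hp : ∀ᵐ ω ∂μ, 0 < (μ⟦A | m⟧) ω) {g : Ω → ℝ} (hg : StronglyMeasurable[m] g) {K : ℝ}
    (hK : ∀ ω, |g ω| ≤ K) : Integrable (A.indicator fun ω => g ω / (μ⟦A | m⟧) ω) μ := by
  have hgp : StronglyMeasurable[m] fun ω => g ω / (μ⟦A | m⟧) ω :=
    (hg.measurable.div stronglyMeasurable_condExp.measurable).stronglyMeasurable
  have hpm : Measurable[m] fun ω => ENNReal.ofReal ((μ⟦A | m⟧) ω) :=
    ENNReal.measurable_ofReal.comp stronglyMeasurable_condExp.measurable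
  rw [integrable_indicator_iff hA]
  refine ⟨(hgp.mono hm).aestronglyMeasurable, ?_⟩
  have hen : Measurable[m] fun ω => ‖g ω / (μ⟦A | m⟧) ω‖ₑ := hgp.enorm
  rw [HasFiniteIntegral, ← lintegral_trim hm hen, trim_restrict_eq_withDensity_condExp hm hA,
    lintegral_withDensity_eq_lintegral_mul _ hpm hen, lintegral_trim hm (hpm.mul hen)]
  refine (lintegral_mono_ae (g := fun _ => ENNReal.ofReal K) ?_).trans_lt (by simp)
  -- The density `μ⟦A | m⟧` cancels the denominator and leaves `|g| ≤ K`.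
  filter_upwards [hp] with ω h
  rw [Pi.mul_apply, ← Real.enorm_of_nonneg h.le, ← enorm_mul, mul_div_cancel₀ _ h.ne',
    Real.enorm_eq_ofReal_abs]
  exact ENNReal.ofReal_le_ofReal (hK ω)

lemma condExp_indicator_div_condExp (hm : m ≤ mΩ) {A : Set Ω} (hA : MeasurableSet[mΩ] A)
    (hp : ∀ᵐ ω ∂μ, 0 < (μ⟦A | m⟧) ω) {g : Ω → ℝ} (hg : StronglyMeasurable[m] g) {K : ℝ}
    (hK : ∀ ω, |g ω| ≤ K) : μ[A.indicator fun ω => g ω / (μ⟦A | m⟧) ω | m] =ᵐ[μ] g := by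
  have hgp : StronglyMeasurable[m] fun ω => g ω / (μ⟦A | m⟧) ω :=
    (hg.measurable.div stronglyMeasurable_condExp.measurable).stronglyMeasurable
  have hi : Integrable (A.indicator fun _ => (1 : ℝ)) μ := (integrable_const 1).indicator hA
  have heq : (A.indicator fun ω => g ω / (μ⟦A | m⟧) ω)
      = (fun ω => g ω / (μ⟦A | m⟧) ω) * A.indicator fun _ => (1 : ℝ) := by
    ext ω; by_cases h : ω ∈ A <;> simp [h]
  have hint := integrable_indicator_div_condExp hm hA hp hg hK
  rw [heq] at hint ⊢
  filter_upwards [condExp_mul_of_stronglyMeasurable_left hgp hint hi, hp] with ω h1 h2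
  rw [h1, Pi.mul_apply, div_mul_cancel₀ _ h2.ne']

end InverseProbabilityWeighting

/-! ### The martingale central limit theorem. -/

section CentralLimitTheorem

variable {Ω : ℕ → Type*} [mΩ : ∀ n, MeasurableSpace (Ω n)] {μ : ∀ n, Measure (Ω n)}
  [∀ n, IsProbabilityMeasure (μ n)]

/-- Near `c` continuity of `φ` bounds the integrand by `e / 2`; away from `c` it is at most `B + |φ
c|` on an event of vanishing probability. Only the values `φ (X n)` need a bound, so an exponential
`φ` is allowed. -/
lemma tendsto_integral_abs_comp_sub_of_tendstoInProbabilityConst {X : ∀ n, Ω n → ℝ}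
    (hX : ∀ n, Measurable (X n)) {c : ℝ} (hXc : TendstoInProbabilityConst μ X c) {φ : ℝ → ℝ}
    (hφ : Continuous φ) {B : ℝ} (hB : ∀ n, ∀ᵐ ω ∂(μ n), |φ (X n ω)| ≤ B) :
    Tendsto (fun n => ∫ ω, |φ (X n ω) - φ c| ∂(μ n)) atTop (𝓝 0) := by
  have hB0 : 0 ≤ B := by
    obtain ⟨ω, h⟩ := (hB 0).exists
    exact (abs_nonneg _).trans h
  rw [Metric.tendsto_atTop]
  intro e he
  obtain ⟨ρ, hρ, hc⟩ := Metric.continuous_iff.1 hφ c (e / 2) (by positivity)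
  have ht : Tendsto (fun n => (B + |φ c|) * (μ n).real {ω | ρ ≤ |X n ω - c|}) atTop (𝓝 0) := by
    have := ((ENNReal.tendsto_toReal ENNReal.zero_ne_top).comp (hXc ρ hρ)).const_mul (B + |φ c|)
    simpa [Measure.real] using this
  obtain ⟨N, hN⟩ := Metric.tendsto_atTop.1 ht (e / 2) (by positivity)
  refine ⟨N, fun n hn => ?_⟩
  specialize hN n hn
  set A : Set (Ω n) := {ω | ρ ≤ |X n ω - c|} with hA
  have hAm : MeasurableSet A := measurableSet_le measurable_const ((hX n).sub_const c).abs
  rw [Real.dist_eq, sub_zero, abs_of_nonneg (by positivity)] at hN ⊢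
  have hi : Integrable (fun ω => e / 2 + A.indicator (fun _ => B + |φ c|) ω) (μ n) :=
    (integrable_const _).add ((integrable_const _).indicator hAm)
  calc ∫ ω, |φ (X n ω) - φ c| ∂(μ n)
      ≤ ∫ ω, (e / 2 + A.indicator (fun _ => B + |φ c|) ω) ∂(μ n) := by
        refine integral_mono_of_nonneg (ae_of_all _ fun _ => abs_nonneg _) hi ?_
        filter_upwards [hB n] with ω h
        by_cases hω : ω ∈ A
        · simp only [hω, Set.indicator_of_mem]
          linarith [abs_sub (φ (X n ω)) (φ c)]
        · simp only [hω, not_false_eq_true, Set.indicator_of_notMem, add_zero]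
          simp only [hA, Set.mem_ofPred_eq, not_le] at hω
          exact (hc _ hω).le
    _ = e / 2 + (B + |φ c|) * (μ n).real A := by
        rw [integral_add (integrable_const _) ((integrable_const _).indicator hAm),
          integral_indicator hAm]
        simp [mul_comm]
    _ < e := by linarith

/-- **Martingale central limit theorem** for triangular arrays of martingale differences whose
`n`-th row is bounded by `ε n = O(1 / √n)`. -/
theorem tendstoInDistribution_sum_of_condExp_eq_zero {𝓕 : ∀ n, Filtration ℕ (mΩ n)}
    {d v : ∀ n, ℕ → Ω n → ℝ} {ε : ℕ → ℝ} {K η : ℝ}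
    (hd : ∀ n, ∀ t < n, StronglyMeasurable[𝓕 n (t + 1)] (d n t))
    (hv : ∀ n, ∀ t < n, StronglyMeasurable[𝓕 n t] (v n t))
    (hbd : ∀ n, ∀ t < n, ∀ᵐ ω ∂(μ n), |d n t ω| ≤ ε n)
    (h0 : ∀ n, ∀ t < n, (μ n)[d n t | 𝓕 n t] =ᵐ[μ n] 0)
    (hvar : ∀ n, ∀ t < n, v n t =ᵐ[μ n] (μ n)[fun ω => d n t ω ^ 2 | 𝓕 n t])
    (hε0 : ∀ n, 0 ≤ ε n) (hε : Tendsto ε atTop (𝓝 0)) (hK : ∀ n, n * ε n ^ 2 ≤ K)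
    (hη : TendstoInProbabilityConst μ (fun n ω => ∑ t ∈ Finset.range n, v n t ω) (η ^ 2)) :
    TendstoInDistribution (fun n ω => ∑ t ∈ Finset.range n, d n t ω) atTop (id : ℝ → ℝ) μ
      (gaussianReal 0 (Real.toNNReal (η ^ 2))) := by
  have hSm : ∀ n, Measurable (fun ω => ∑ t ∈ Finset.range n, d n t ω) := fun n =>
    ((stronglyMeasurable_sum_range (hd n)).mono ((𝓕 n).le n)).measurable
  have hVm : ∀ n, Measurable (fun ω => ∑ t ∈ Finset.range n, v n t ω) := fun n => by
    refine Finset.measurable_fun_sum _ fun t ht => ?_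
    exact ((hv n t (Finset.mem_range.1 ht)).mono ((𝓕 n).le t)).measurable
  have hbv : ∀ n, ∀ t < n, ∀ᵐ ω ∂(μ n), 0 ≤ v n t ω ∧ v n t ω ≤ ε n ^ 2 := by
    intro n t ht
    have hb : ∀ᵐ ω ∂(μ n), d n t ω ^ 2 ≤ ε n ^ 2 := by
      filter_upwards [hbd n t ht] with ω h using sq_le_sq' (abs_le.1 h).1 (abs_le.1 h).2
    have hi : Integrable (fun ω => d n t ω ^ 2) (μ n) := by
      refine Integrable.of_bound (((hd n t ht).mono ((𝓕 n).le _)).aestronglyMeasurable.pow 2)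
        (ε n ^ 2) ?_
      filter_upwards [hb] with ω h
      rwa [Real.norm_of_nonneg (sq_nonneg _)]
    have h1 := condExp_mono (m := 𝓕 n t) hi (integrable_const (ε n ^ 2)) hb
    have h2 : 0 ≤ᵐ[μ n] (μ n)[fun ω => d n t ω ^ 2 | 𝓕 n t] :=
      condExp_nonneg (ae_of_all _ fun ω => sq_nonneg _)
    rw [condExp_const ((𝓕 n).le t)] at h1
    filter_upwards [h1, h2, hvar n t ht] with ω h1 h2 h3
    rw [h3]
    exact ⟨h2, h1⟩
  have hVb : ∀ n, ∀ᵐ ω ∂(μ n), ∑ t ∈ Finset.range n, v n t ω ≤ K := by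
    intro n
    have hall : ∀ᵐ ω ∂(μ n), ∀ t ∈ Finset.range n, v n t ω ≤ ε n ^ 2 := by
      rw [Finset.eventually_all]
      intro t ht
      filter_upwards [hbv n t (Finset.mem_range.1 ht)] with ω h using h.2
    filter_upwards [hall] with ω h
    exact (Finset.sum_le_sum h).trans (by simpa using hK n)
  refine ⟨fun n => (hSm n).aemeasurable, by fun_prop, ?_⟩
  refine ProbabilityMeasure.tendsto_iff_tendsto_charFun.2 fun θ => ?_
  simp only [ProbabilityMeasure.coe_mk, Measure.map_id, charFun_gaussianReal]
  set φ : ℝ → ℝ := fun x => Real.exp (θ ^ 2 / 2 * x) with hφ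
  have hφc : Continuous φ := by fun_prop
  have hchar : ∀ n, charFun ((μ n).map (fun ω => ∑ t ∈ Finset.range n, d n t ω)) θ
      = ∫ ω, Complex.exp ((θ * ∑ t ∈ Finset.range n, d n t ω : ℝ) * Complex.I) ∂(μ n) := by
    intro n
    rw [charFun_apply_real, integral_map (hSm n).aemeasurable (by fun_prop)]
    push_cast
    rfl
  have hcomp : Tendsto (fun n => ∫ ω, Complex.exp ((θ * ∑ t ∈ Finset.range n, d n t ω : ℝ)
      * Complex.I + (θ ^ 2 / 2 * ∑ t ∈ Finset.range n, v n t ω : ℝ)) ∂(μ n)) atTop (𝓝 1) := by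
    rw [tendsto_iff_norm_sub_tendsto_zero]
    have hlim : Tendsto (fun n => K * (4 * |θ| ^ 3 * Real.exp (θ ^ 2 / 2 * K)) * ε n)
        atTop (𝓝 0) := by simpa using hε.const_mul _
    refine squeeze_zero' (Eventually.of_forall fun _ => norm_nonneg _) ?_ hlim
    have hev : ∀ᶠ n in atTop, |θ| * ε n ≤ 1 :=
      (by simpa using hε.const_mul |θ| : Tendsto (fun n => |θ| * ε n) atTop (𝓝 0)).eventually_le_const
        one_pos
    filter_upwards [hev] with n hn
    refine (norm_integral_exp_compensated_sub_one_le (hd n) (hv n) (hbd n) (h0 n) (hvar n)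
      (hbv n) hn (hK n)).trans ?_
    -- The total of the cubic errors is `n ε³ = (n ε²) ε ≤ K ε`, which tends to `0`.
    calc (n : ℝ) * (4 * (|θ| * ε n) ^ 3 * Real.exp (θ ^ 2 / 2 * K))
        = (n * ε n ^ 2) * (4 * |θ| ^ 3 * Real.exp (θ ^ 2 / 2 * K)) * ε n := by ring
      _ ≤ _ := by
        have := hε0 n
        gcongr
        exact hK n
  have hdiff : Tendsto (fun n => ∫ ω, Complex.exp ((θ * ∑ t ∈ Finset.range n, d n t ω : ℝ)
      * Complex.I + (θ ^ 2 / 2 * ∑ t ∈ Finset.range n, v n t ω : ℝ)) ∂(μ n)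
      - (φ (η ^ 2) : ℂ) * charFun ((μ n).map (fun ω => ∑ t ∈ Finset.range n, d n t ω)) θ)
      atTop (𝓝 0) := by
    have hφb : ∀ n, ∀ᵐ ω ∂(μ n), |φ (∑ t ∈ Finset.range n, v n t ω)| ≤ φ K := by
      intro n
      filter_upwards [hVb n] with ω h
      rw [abs_of_pos (Real.exp_pos _)]
      refine Real.exp_le_exp.2 ?_
      gcongr
    -- Since `exp(iθS)` has modulus one, the difference is at most the mean of `|φ(V) - φ(η²)|`.
    refine squeeze_zero_norm (fun n => ?_)
      (tendsto_integral_abs_comp_sub_of_tendstoInProbabilityConst hVm hη hφc hφb)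
    have hi1 : Integrable (fun ω => Complex.exp ((θ * ∑ t ∈ Finset.range n, d n t ω : ℝ)
        * Complex.I)) (μ n) := by
      refine Integrable.of_bound (C := 1) ?_ (ae_of_all _ fun ω => ?_)
      · have := hSm n
        refine Measurable.aestronglyMeasurable ?_
        fun_prop
      · rw [Complex.norm_exp_ofReal_mul_I]
    have hsplit : ∀ ω, Complex.exp ((θ * ∑ t ∈ Finset.range n, d n t ω : ℝ)
        * Complex.I + (θ ^ 2 / 2 * ∑ t ∈ Finset.range n, v n t ω : ℝ))
        = (φ (∑ t ∈ Finset.range n, v n t ω) : ℂ)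
          * Complex.exp ((θ * ∑ t ∈ Finset.range n, d n t ω : ℝ) * Complex.I) := by
      intro ω
      rw [Complex.exp_add, hφ, Complex.ofReal_exp, mul_comm]
    have hi2 : Integrable (fun ω => (φ (∑ t ∈ Finset.range n, v n t ω) : ℂ)
        * Complex.exp ((θ * ∑ t ∈ Finset.range n, d n t ω : ℝ) * Complex.I)) (μ n) := by
      refine hi1.bdd_mul (c := φ K) ?_ ?_
      · have := hVm n
        refine Measurable.aestronglyMeasurable ?_
        fun_prop
      · filter_upwards [hφb n] with ω h
        rwa [Complex.norm_real]
    simp_rw [hsplit]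
    rw [hchar, ← integral_const_mul, ← integral_sub hi2 (hi1.const_mul _)]
    refine (norm_integral_le_integral_norm _).trans (le_of_eq ?_)
    congr 1
    ext ω
    rw [← sub_mul, norm_mul, Complex.norm_exp_ofReal_mul_I, mul_one, ← Complex.ofReal_sub,
      Complex.norm_real, Real.norm_eq_abs]
  -- `φ(η²)` times the characteristic function tends to `1`; dividing by `φ(η²)` gives the limit.
  have hmain := ((hcomp.sub hdiff).const_mul ((φ (η ^ 2) : ℂ)⁻¹))
  have hne : (φ (η ^ 2) : ℂ) ≠ 0 := Complex.ofReal_ne_zero.2 (Real.exp_pos _).ne'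
  have hval : (φ (η ^ 2) : ℂ)⁻¹ * (1 - 0) = Complex.exp (θ * (0 : ℝ) * Complex.I
      - ((Real.toNNReal (η ^ 2) : ℝ≥0) : ℝ) * θ ^ 2 / 2) := by
    rw [Real.coe_toNNReal _ (sq_nonneg η), hφ, sub_zero, mul_one, Complex.ofReal_exp,
      ← Complex.exp_neg]
    congr 1
    push_cast
    ring
  rw [hval] at hmain
  refine hmain.congr fun n => ?_
  rw [sub_sub_cancel, inv_mul_cancel_left₀ hne]

end CentralLimitTheorem

lemma sum_Icc_one_eq_sum_range {M : Type*} [AddCommMonoid M] (f : ℕ → M) (n : ℕ) :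
    ∑ t ∈ Finset.Icc 1 n, f t = ∑ t ∈ Finset.range n, f (t + 1) := by
  rw [Finset.range_eq_Ico, Finset.sum_Ico_add' f 0 n 1]
  rfl

/-! ### The Horvitz-Thompson errors as martingale differences. -/

namespace TimeSeriesExperiment.Experiment

variable {Ω : Type*} [mΩ : MeasurableSpace Ω] (E : Experiment Ω) (y : PotentialOutcomes)

/-- The update overwrites `W (t + 1)`, the only entry of the path not known at time `t`. Times are
written `t + 1` here and below so that the past is `𝓕 t`. -/
lemma stronglyMeasurable_outcomeIf (t : ℕ) (b : Bool) :
    StronglyMeasurable[E.𝓕 t] (E.outcomeIf y (t + 1) b) := by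
  have hpath : Measurable[E.𝓕 t] fun ω =>
      path (Function.update (fun s => E.W s ω) (t + 1) b) (t + 1) := by
    refine @measurable_pi_lambda _ _ _ (E.𝓕 t) _ _ fun i => ?_
    by_cases h : (i : ℕ) = t
    · have : (fun ω => path (Function.update (fun s => E.W s ω) (t + 1) b) (t + 1) i)
          = fun _ => b := by
        ext ω; simp [path, h]
      rw [this]
      exact measurable_const
    · have : (fun ω => path (Function.update (fun s => E.W s ω) (t + 1) b) (t + 1) i)
          = E.W (i + 1) := by
        ext ω; simp [path, h]
      rw [this]
      exact (E.measurable_W (i + 1) (by omega)).mono (E.𝓕.mono (by omega)) le_rfl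
  exact ((Measurable.of_discrete (f := y (t + 1))).comp hpath).stronglyMeasurable

/-- There are finitely many paths of length `t`; the bound may depend on `t`, which suffices for
integrability. -/
lemma exists_abs_outcomeIf_le (t : ℕ) (b : Bool) : ∃ K, ∀ ω, |E.outcomeIf y t b ω| ≤ K :=
  ⟨∑ w, |y t w|, fun _ =>
    Finset.single_le_sum (f := fun w => |y t w|) (fun _ _ => abs_nonneg _) (Finset.mem_univ _)⟩

lemma measurableSet_W_eq (t : ℕ) (b : Bool) :
    MeasurableSet[E.𝓕 (t + 1)] {ω | E.W (t + 1) ω = b} :=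
  E.measurable_W (t + 1) (by omega) (measurableSet_singleton b)

lemma stronglyMeasurable_propensity (t : ℕ) (b : Bool) :
    StronglyMeasurable[E.𝓕 t] (E.propensity y (t + 1) b) := stronglyMeasurable_condExp

lemma propensity_false_ae_eq (t : ℕ) :
    E.propensity y (t + 1) false =ᵐ[E.law y] fun ω => 1 - E.propensity y (t + 1) true ω := by
  have hA : MeasurableSet {ω | E.W (t + 1) ω = true} := E.𝓕.le _ _ (E.measurableSet_W_eq t true)
  have heq : ({ω | E.W (t + 1) ω = false}.indicator fun _ => (1 : ℝ))
      = (fun _ => (1 : ℝ)) - {ω | E.W (t + 1) ω = true}.indicator fun _ => (1 : ℝ) := by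
    ext ω
    cases h : E.W (t + 1) ω <;> simp [h]
  have h := condExp_sub (μ := E.law y) (integrable_const (1 : ℝ))
    ((integrable_const (1 : ℝ)).indicator hA) (E.𝓕 t)
  rw [← heq, condExp_const (E.𝓕.le t)] at h
  exact h

lemma error_eq (t : ℕ) : E.error y (t + 1) =
    ({ω | E.W (t + 1) ω = true}.indicator
        (fun ω => E.outcomeIf y (t + 1) true ω / E.propensity y (t + 1) true ω)
      - {ω | E.W (t + 1) ω = false}.indicator
        (fun ω => E.outcomeIf y (t + 1) false ω / E.propensity y (t + 1) false ω))
      - (E.outcomeIf y (t + 1) true - E.outcomeIf y (t + 1) false) := by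
  ext ω
  cases h : E.W (t + 1) ω <;> simp [error, estimator, effect, h]

lemma stronglyMeasurable_error (t : ℕ) :
    StronglyMeasurable[E.𝓕 (t + 1)] (E.error y (t + 1)) := by
  have h : ∀ b, StronglyMeasurable[E.𝓕 (t + 1)] (E.outcomeIf y (t + 1) b) := fun b =>
    (E.stronglyMeasurable_outcomeIf y t b).mono (E.𝓕.mono (by omega))
  have hp : ∀ b, StronglyMeasurable[E.𝓕 (t + 1)] (E.propensity y (t + 1) b) := fun b =>
    (E.stronglyMeasurable_propensity y t b).mono (E.𝓕.mono (by omega))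
  have hq : ∀ b, StronglyMeasurable[E.𝓕 (t + 1)] ({ω | E.W (t + 1) ω = b}.indicator
      (fun ω => E.outcomeIf y (t + 1) b ω / E.propensity y (t + 1) b ω)) := fun b =>
    StronglyMeasurable.indicator ((h b).measurable.div (hp b).measurable).stronglyMeasurable
      (E.measurableSet_W_eq t b)
  rw [error_eq]
  exact ((hq true).sub (hq false)).sub ((h true).sub (h false))

variable {E y}

lemma propensity_pos {t : ℕ} (hp : ∀ᵐ ω ∂(E.law y),
    0 < E.propensity y (t + 1) true ω ∧ E.propensity y (t + 1) true ω < 1) (b : Bool) :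
    ∀ᵐ ω ∂(E.law y), 0 < E.propensity y (t + 1) b ω := by
  filter_upwards [hp, E.propensity_false_ae_eq y t] with ω h h'
  cases b
  · rw [h']; linarith [h.2]
  · exact h.1

lemma integrable_outcomeIf (t : ℕ) (b : Bool) :
    Integrable (E.outcomeIf y (t + 1) b) (E.law y) := by
  obtain ⟨K, hK⟩ := E.exists_abs_outcomeIf_le y (t + 1) b
  exact Integrable.of_bound
    ((E.stronglyMeasurable_outcomeIf y t b).mono (E.𝓕.le t)).aestronglyMeasurable K
    (ae_of_all _ hK)

lemma integrable_weightedOutcome {t : ℕ} (hp : ∀ᵐ ω ∂(E.law y),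
    0 < E.propensity y (t + 1) true ω ∧ E.propensity y (t + 1) true ω < 1) (b : Bool) :
    Integrable ({ω | E.W (t + 1) ω = b}.indicator
      (fun ω => E.outcomeIf y (t + 1) b ω / E.propensity y (t + 1) b ω)) (E.law y) := by
  obtain ⟨K, hK⟩ := E.exists_abs_outcomeIf_le y (t + 1) b
  exact integrable_indicator_div_condExp (E.𝓕.le t) (E.𝓕.le _ _ (E.measurableSet_W_eq t b))
    (propensity_pos hp b) (E.stronglyMeasurable_outcomeIf y t b) hK

lemma integrable_error {t : ℕ} (hp : ∀ᵐ ω ∂(E.law y),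
    0 < E.propensity y (t + 1) true ω ∧ E.propensity y (t + 1) true ω < 1) :
    Integrable (E.error y (t + 1)) (E.law y) := by
  rw [error_eq]
  exact ((integrable_weightedOutcome hp true).sub (integrable_weightedOutcome hp false)).sub
    ((integrable_outcomeIf t true).sub (integrable_outcomeIf t false))

lemma condExp_error {t : ℕ} (hp : ∀ᵐ ω ∂(E.law y),
    0 < E.propensity y (t + 1) true ω ∧ E.propensity y (t + 1) true ω < 1) :
    (E.law y)[E.error y (t + 1) | E.𝓕 t] =ᵐ[E.law y] 0 := by
  have hc : ∀ b, (E.law y)[{ω | E.W (t + 1) ω = b}.indicator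
      (fun ω => E.outcomeIf y (t + 1) b ω / E.propensity y (t + 1) b ω) | E.𝓕 t]
      =ᵐ[E.law y] E.outcomeIf y (t + 1) b := fun b => by
    obtain ⟨K, hK⟩ := E.exists_abs_outcomeIf_le y (t + 1) b
    exact condExp_indicator_div_condExp (E.𝓕.le t) (E.𝓕.le _ _ (E.measurableSet_W_eq t b))
      (propensity_pos hp b) (E.stronglyMeasurable_outcomeIf y t b) hK
  have hY : Integrable (E.outcomeIf y (t + 1) true - E.outcomeIf y (t + 1) false) (E.law y) :=
    (integrable_outcomeIf t true).sub (integrable_outcomeIf t false)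
  have hw := integrable_weightedOutcome hp
  rw [error_eq]
  filter_upwards [condExp_sub ((hw true).sub (hw false)) hY (E.𝓕 t),
    condExp_sub (hw true) (hw false) (E.𝓕 t), hc true, hc false] with ω h1 h2 h3 h4
  rw [h1, Pi.sub_apply, h2, Pi.sub_apply, h3, h4, condExp_of_stronglyMeasurable (E.𝓕.le t)
    ((E.stronglyMeasurable_outcomeIf y t true).sub (E.stronglyMeasurable_outcomeIf y t false)) hY]
  simp

lemma abs_error_le {t : ℕ} {M δ : ℝ} (hδ : 0 < δ) (hM : ∀ w, |y (t + 1) w| ≤ M)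
    (hp : ∀ᵐ ω ∂(E.law y),
      δ ≤ E.propensity y (t + 1) true ω ∧ E.propensity y (t + 1) true ω ≤ 1 - δ) :
    ∀ᵐ ω ∂(E.law y), |E.error y (t + 1) ω| ≤ M / δ + 2 * M := by
  filter_upwards [hp, E.propensity_false_ae_eq y t] with ω h h'
  have hM0 : 0 ≤ M := (abs_nonneg _).trans (hM fun _ => true)
  have hY : ∀ b, |E.outcomeIf y (t + 1) b ω| ≤ M := fun b => hM _
  have hpb : ∀ b, δ ≤ E.propensity y (t + 1) b ω := by
    rintro (_ | _)
    · rw [h']; linarith [h.2]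
    · exact h.1
  have hq : ∀ b, |E.outcomeIf y (t + 1) b ω / E.propensity y (t + 1) b ω| ≤ M / δ := fun b => by
    rw [abs_div, abs_of_pos (hδ.trans_le (hpb b))]
    exact div_le_div₀ hM0 (hY b) hδ (hpb b)
  -- Only one of the two weighted terms is nonzero, so `M / δ` is enough.
  have hest : |E.estimator y (t + 1) ω| ≤ M / δ := by
    cases hW : E.W (t + 1) ω
    · simpa [estimator, hW] using hq false
    · simpa [estimator, hW] using hq true
  have heff : |E.effect y (t + 1) ω| ≤ 2 * M := by
    refine (abs_sub _ _).trans ?_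
    linarith [hY true, hY false]
  refine (abs_sub _ _).trans ?_
  linarith

variable (E y) in
lemma scaledError_eq (T : ℕ) : E.scaledError y T =
    fun ω => √(T : ℝ) * (1 / (T : ℝ)) * ∑ t ∈ Finset.range T, E.error y (t + 1) ω := by
  ext ω
  rw [scaledError, sum_Icc_one_eq_sum_range (fun t => E.error y t ω), mul_assoc]

variable (E y) in
lemma scaledError_eq_sqrt_mul_sub (T : ℕ) (ω : Ω) : E.scaledError y T ω =
    √(T : ℝ) * (E.avgEstimator y T ω - E.avgEffect y T ω) := by
  simp only [scaledError, avgEstimator, avgEffect, error, Finset.sum_sub_distrib]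
  ring

lemma Probabilistic.succ {T : ℕ} (h : E.Probabilistic y T) {t : ℕ} (ht : t < T) :
    ∀ᵐ ω ∂(E.law y), 0 < E.propensity y (t + 1) true ω ∧ E.propensity y (t + 1) true ω < 1 :=
  h (t + 1) (Finset.mem_Icc.2 ⟨by omega, ht⟩)

lemma integral_scaledError {T : ℕ} (h : E.Probabilistic y T) :
    ∫ ω, E.scaledError y T ω ∂(E.law y) = 0 := by
  rw [scaledError_eq, integral_const_mul, integral_finsetSum _ fun t ht =>
    integrable_error (h.succ (Finset.mem_range.1 ht)), Finset.sum_eq_zero, mul_zero]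
  intro t ht
  rw [← integral_condExp (E.𝓕.le t), integral_congr_ae
    (condExp_error (h.succ (Finset.mem_range.1 ht)))]
  simp

lemma evariance_scaledError {T : ℕ} (hT : 1 ≤ T) (h : E.Probabilistic y T) :
    eVar[E.scaledError y T; E.law y] =
      (T : ℝ≥0∞)⁻¹ * ∑ t ∈ Finset.Icc 1 T, eVar[E.error y t; E.law y] := by
  have hT0 : (0 : ℝ) < T := by exact_mod_cast hT
  have hsq : (√(T : ℝ) * (1 / (T : ℝ))) ^ 2 = (T : ℝ)⁻¹ := by
    rw [mul_pow, Real.sq_sqrt hT0.le]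
    field_simp
  rw [scaledError_eq, evariance_mul, hsq, ENNReal.ofReal_inv_of_pos hT0, ENNReal.ofReal_natCast,
    evariance_sum_range_of_condExp_eq_zero (fun t _ => E.stronglyMeasurable_error y t)
      (fun t ht => integrable_error (h.succ ht)) (fun t ht => condExp_error (h.succ ht)),
    sum_Icc_one_eq_sum_range (fun t => eVar[E.error y t; E.law y])]

lemma memLp_error_and_variance_le {t : ℕ} {C : ℝ}
    (hC : ∀ᵐ ω ∂(E.law y), |E.error y (t + 1) ω| ≤ C) :
    MemLp (E.error y (t + 1)) 2 (E.law y) ∧ Var[E.error y (t + 1); E.law y] ≤ C ^ 2 := by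
  have hm : AEStronglyMeasurable (E.error y (t + 1)) (E.law y) :=
    ((E.stronglyMeasurable_error y t).mono (E.𝓕.le _)).aestronglyMeasurable
  refine ⟨MemLp.of_bound hm C hC, (variance_le_expectation_sq hm).trans ?_⟩
  refine (integral_mono_of_nonneg (ae_of_all _ fun _ => sq_nonneg _)
    (integrable_const (C ^ 2)) ?_).trans (by simp)
  filter_upwards [hC] with ω h using sq_le_sq' (abs_le.1 h).1 (abs_le.1 h).2

lemma memLp_scaledError {T : ℕ} (h : ∀ t ∈ Finset.Icc 1 T, MemLp (E.error y t) 2 (E.law y)) :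
    MemLp (E.scaledError y T) 2 (E.law y) := by
  have hsum : MemLp (fun ω => ∑ t ∈ Finset.Icc 1 T, E.error y t ω) 2 (E.law y) :=
    memLp_finsetSum _ h
  exact (hsum.const_mul (1 / (T : ℝ))).const_mul √(T : ℝ)

end TimeSeriesExperiment.Experiment

/-! ### Assembly: variance identity, boundedness in probability, limit law. -/

theorem theorem3 {Ω : ℕ → Type*} [∀ T, MeasurableSpace (Ω T)]
    (E : ∀ T, Experiment (Ω T)) (y : ℕ → PotentialOutcomes)
    (hna : ∀ T, (E T).NonAnticipating T)
    (hprob : ∀ T, (E T).Probabilistic (y T) T) :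
    (∀ T : ℕ, 1 ≤ T →
      eVar[(E T).scaledError (y T) T; (E T).law (y T)] =
        (T : ℝ≥0∞)⁻¹ * ∑ t ∈ Finset.Icc 1 T, eVar[(E T).error (y T) t; (E T).law (y T)]) ∧
    ((∃ M : ℝ, ∀ T, ∀ t ∈ Finset.Icc 1 T, ∀ w : Fin t → Bool, |y T t w| ≤ M) →
      (∃ δ : ℝ, 0 < δ ∧ ∀ T, ∀ t ∈ Finset.Icc 1 T, ∀ᵐ ω ∂((E T).law (y T)),
        δ ≤ (E T).propensity (y T) t true ω ∧ (E T).propensity (y T) t true ω ≤ 1 - δ) →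
      (∃ C : ℝ, ∀ T, ∀ t ∈ Finset.Icc 1 T,
        MemLp ((E T).error (y T) t) 2 ((E T).law (y T)) ∧
          Var[(E T).error (y T) t; (E T).law (y T)] ≤ C) ∧
      (∀ T : ℕ, 1 ≤ T →
        Var[(E T).scaledError (y T) T; (E T).law (y T)] =
          (1 / (T : ℝ)) * ∑ t ∈ Finset.Icc 1 T, Var[(E T).error (y T) t; (E T).law (y T)]) ∧
      BoundedInProbability (fun T => (E T).law (y T))
        (fun T ω => √(T : ℝ) *
          ((E T).avgEstimator (y T) T ω - (E T).avgEffect (y T) T ω)) ∧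
      (∀ η : ℝ,
        TendstoInProbabilityConst (fun T => (E T).law (y T))
          (fun T => (E T).avgCondVar (y T) T) (η ^ 2) →
        TendstoInDistribution (fun T => (E T).scaledError (y T) T) atTop (id : ℝ → ℝ)
          (fun T => (E T).law (y T)) (gaussianReal 0 (Real.toNNReal (η ^ 2))))) := by
  refine ⟨fun T hT => Experiment.evariance_scaledError hT (hprob T), ?_⟩
  rintro ⟨M, hM⟩ ⟨δ, hδ, hp⟩
  set C : ℝ := M / δ + 2 * M with hC
  have hb : ∀ T, ∀ t < T, ∀ᵐ ω ∂((E T).law (y T)), |(E T).error (y T) (t + 1) ω| ≤ C :=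
    fun T t ht => Experiment.abs_error_le hδ
      (hM T (t + 1) (Finset.mem_Icc.2 ⟨by omega, ht⟩)) (hp T (t + 1) (Finset.mem_Icc.2 ⟨by omega, ht⟩))
  have hL : ∀ T, ∀ t ∈ Finset.Icc 1 T, MemLp ((E T).error (y T) t) 2 ((E T).law (y T)) ∧
      Var[(E T).error (y T) t; (E T).law (y T)] ≤ C ^ 2 := by
    intro T t ht
    obtain ⟨h1, h2⟩ := Finset.mem_Icc.1 ht
    obtain ⟨s, rfl⟩ := Nat.exists_eq_succ_of_ne_zero (by omega : t ≠ 0)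
    exact Experiment.memLp_error_and_variance_le (hb T s h2)
  have hVar : ∀ T : ℕ, 1 ≤ T → Var[(E T).scaledError (y T) T; (E T).law (y T)] =
      (1 / (T : ℝ)) * ∑ t ∈ Finset.Icc 1 T, Var[(E T).error (y T) t; (E T).law (y T)] := by
    intro T hT
    -- Real variances are `toReal` of extended ones, so the sum passes through once every term is
    -- finite.
    simp only [variance]
    rw [Experiment.evariance_scaledError hT (hprob T), ENNReal.toReal_mul,
      ENNReal.toReal_sum fun t ht => evariance_ne_top (hL T t ht).1]
    simp
  refine ⟨⟨C ^ 2, hL⟩, hVar, ?_, ?_⟩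
  · have hVarle : ∀ T : ℕ, 1 ≤ T → Var[(E T).scaledError (y T) T; (E T).law (y T)] ≤ C ^ 2 := by
      intro T hT
      have hT0 : (0 : ℝ) < T := by exact_mod_cast hT
      rw [hVar T hT]
      calc (1 / (T : ℝ)) * ∑ t ∈ Finset.Icc 1 T, Var[(E T).error (y T) t; (E T).law (y T)]
          ≤ (1 / (T : ℝ)) * ∑ t ∈ Finset.Icc 1 T, C ^ 2 := by
            gcongr with t ht
            exact (hL T t ht).2
        _ = C ^ 2 := by
            simp
            field_simp
    intro ε hε
    -- `ε` may be `∞`, so a finite `r` below it is used. The threshold squared is `(C² + 1) / r`,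
    -- with `+ 1` keeping it positive when `C = 0`; Chebyshev then gives at most `r`.
    obtain ⟨r, hr0, hrε⟩ := ENNReal.lt_iff_exists_nnreal_btwn.1 hε
    have hr : (0 : ℝ) < r := by exact_mod_cast hr0
    have hpos : 0 < (C ^ 2 + 1) / r := by positivity
    refine ⟨√((C ^ 2 + 1) / r), fun T hT => ?_⟩
    have hmem : MemLp ((E T).scaledError (y T) T) 2 ((E T).law (y T)) :=
      Experiment.memLp_scaledError fun t ht => (hL T t ht).1
    have hcheb := meas_ge_le_variance_div_sq hmem (Real.sqrt_pos.2 hpos)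
    rw [Experiment.integral_scaledError (hprob T), Real.sq_sqrt hpos.le] at hcheb
    refine (measure_mono fun ω hω => ?_).trans (hcheb.trans (le_trans ?_ hrε.le))
    · simp only [Set.mem_ofPred_eq, sub_zero] at hω ⊢
      rw [Experiment.scaledError_eq_sqrt_mul_sub]
      exact le_of_lt hω
    · rw [← ENNReal.ofReal_coe_nnreal]
      refine ENNReal.ofReal_le_ofReal ?_
      rw [div_le_iff₀ hpos, mul_div_cancel₀ _ hr.ne']
      linarith [hVarle T hT]
  · intro η hη
    -- This also holds for `T = 0`, where both sides are `0`.
    have hsqrt : ∀ T : ℕ, √(T : ℝ) * (1 / (T : ℝ)) = (√(T : ℝ))⁻¹ := fun T => by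
      rw [mul_one_div, Real.sqrt_div_self', one_div]
    have hsq : ∀ T : ℕ, ((√(T : ℝ))⁻¹) ^ 2 = 1 / (T : ℝ) := fun T => by
      rw [inv_pow, Real.sq_sqrt T.cast_nonneg, one_div]
    have hS : (fun T => (E T).scaledError (y T) T) = fun T ω => ∑ t ∈ Finset.range T,
        (√(T : ℝ))⁻¹ * (E T).error (y T) (t + 1) ω := by
      ext T ω
      simp only [Experiment.scaledError_eq, hsqrt, Finset.mul_sum]
    have hV : (fun T => (E T).avgCondVar (y T) T) = fun T ω => ∑ t ∈ Finset.range T,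
        1 / (T : ℝ) * (Var[(E T).error (y T) (t + 1); (E T).law (y T) | (E T).𝓕 t]) ω := by
      ext T ω
      rw [Experiment.avgCondVar, sum_Icc_one_eq_sum_range (fun t =>
        (Var[(E T).error (y T) t; (E T).law (y T) | (E T).𝓕 (t - 1)]) ω), Finset.mul_sum]
      rfl
    rw [hV] at hη
    rw [hS]
    refine tendstoInDistribution_sum_of_condExp_eq_zero (𝓕 := fun T => (E T).𝓕)
      (d := fun T t ω => (√(T : ℝ))⁻¹ * (E T).error (y T) (t + 1) ω)
      (ε := fun T => |C| * (√(T : ℝ))⁻¹) (K := C ^ 2)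
      (fun T t _ => ((E T).stronglyMeasurable_error (y T) t).const_mul _)
      (fun T t _ => stronglyMeasurable_condVar.const_mul _) ?_ ?_ ?_ (fun T => by positivity)
      ?_ ?_ hη
    · intro T t ht
      filter_upwards [hb T t ht] with ω h
      have hT : 0 ≤ (√(T : ℝ))⁻¹ := by positivity
      rw [abs_mul, abs_of_nonneg hT, mul_comm |C|]
      exact mul_le_mul_of_nonneg_left (h.trans (le_abs_self C)) hT
    · intro T t ht
      have h1 := condExp_smul (μ := (E T).law (y T)) (√(T : ℝ))⁻¹ ((E T).error (y T) (t + 1))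
        ((E T).𝓕 t)
      filter_upwards [h1, Experiment.condExp_error ((hprob T).succ ht)] with ω h1 h2
      refine h1.trans ?_
      simp [h2]
    · intro T t ht
      have h1 := condExp_smul (μ := (E T).law (y T)) (1 / (T : ℝ))
        (fun ω => (E T).error (y T) (t + 1) ω ^ 2) ((E T).𝓕 t)
      have heq : (fun ω => ((√(T : ℝ))⁻¹ * (E T).error (y T) (t + 1) ω) ^ 2)
          = (1 / (T : ℝ)) • fun ω => (E T).error (y T) (t + 1) ω ^ 2 := by
        ext ω
        rw [mul_pow, hsq, Pi.smul_apply, smul_eq_mul]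
      -- The conditional mean is zero, so the conditional variance is the conditional second moment.
      have h2 : Var[(E T).error (y T) (t + 1); (E T).law (y T) | (E T).𝓕 t]
          =ᵐ[(E T).law (y T)]
          ((E T).law (y T))[fun ω => (E T).error (y T) (t + 1) ω ^ 2 | (E T).𝓕 t] := by
        refine condExp_congr_ae ?_
        filter_upwards [Experiment.condExp_error ((hprob T).succ ht)] with ω h
        simp [h]
      simp only [heq]
      filter_upwards [h1, h2] with ω h1 h2
      rw [h1, h2, Pi.smul_apply, smul_eq_mul]
    · have : Tendsto (fun T : ℕ => (√(T : ℝ))⁻¹) atTop (𝓝 0) :=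
        tendsto_inv_atTop_zero.comp (Real.tendsto_sqrt_atTop.comp tendsto_natCast_atTop_atTop)
      simpa using this.const_mul |C|
    · intro T
      rw [mul_pow, hsq, sq_abs]
      rcases T.eq_zero_or_pos with rfl | hT
      · simpa using sq_nonneg C
      · have : (0 : ℝ) < T := by exact_mod_cast hT
        refine le_of_eq ?_
        field_simp
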